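/- Let $P:\mathbb{N}\to\{0,1\}$ be the characteristic function of the primes. For a positive integer $n$ let $\mathbb{Z}_n=\mathbb{Z}/n\mathbb{Z}$, identified with $\{1,2,\dots,n\}$, regard $P$ (restricted to $\{1,\dots,n\}$) as a function on $\mathbb{Z}_n$, and let $$\hat P(\xi)=\sum_{x\in\mathbb{Z}_n}P(x)\,e^{-2\pi i \xi x/n}\qquad(\xi\in\mathbb{Z}_n)$$ be its discrete Fourier transform. 1. For every positive integer $n$, $$\frac1n\sum_{\xi\in\mathbb{Z}_n}|\hat P(\xi)|^2=\sum_{x\in\mathbb{Z}_n}P(x).$$ 2. As $n\to\infty$, $\ \sum_{x\in\mathbb{Z}_n}P(x)\sim \dfrac{n}{\log n}.$ 3. For $C>0$ and $n\ge 2$ let $N_C(n)$ be the number of $\xi\in\mathbb{Z}_n$ with $\frac1n|\hat P(\xi)|^2\ge \dfrac{n}{C\log^2 n}$. Then $N_C(n)=O(C\log n)$ uniformly: there is an absolute constant $K>0$ such that $N_C(n)\le K\,C\log n$ for all integers $n\ge2$ and all real $C>0$. Moreover, the constant is asymptotically $1$: for every $\varepsilon>0$ there is $n_0$ such that $N_C(n)\le(1+\varepsilon)\,C\log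 n$ for all $n\ge n_0$ and all real $C>0$. -/

import Mathlib

/-- The characteristic function `P : ℕ → {0, 1}` of the primes, with real values. -/
noncomputable def primeChar (m : ℕ) : ℝ := if m.Prime then 1 else 0

/-- The representative in `{1, 2, …, n}` of a residue class modulo `n`
(so the zero class is represented by `n`, not by `0`). -/
def ZMod.posRep {n : ℕ} (x : ZMod n) : ℕ := if x = 0 then n else x.val

/-- The function `P : ℤ/n → {0, 1}` given by the restriction of `P` to `{1, 2, …, n}`. -/
noncomputable def primeCharMod (n : ℕ) (x : ZMod n) : ℝ := primeChar x.posRep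

/-- The discrete Fourier transform
`P̂(ξ) = ∑ x : ℤ/n, P(x) e(-ξ x / n)`, where `e(t) = exp (2 π i t)`. -/
noncomputable def primeFourier (n : ℕ) [NeZero n] (ξ : ZMod n) : ℂ :=
  ZMod.dft (fun x : ZMod n => (primeCharMod n x : ℂ)) ξ

/-- The set of frequencies `ξ` modulo `n` for which `|P̂(ξ)|² / n` is at least
`n / (C log² n)`. -/
def largeFrequencies (n : ℕ) [NeZero n] (C : ℝ) : Set (ZMod n) :=
  {ξ | (n : ℝ) / (C * Real.log n ^ 2) ≤ 1 / (n : ℝ) * ‖primeFourier n ξ‖ ^ 2}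

/-! Parseval together with `P ^ 2 = P` gives total energy `π(n)`. Each large frequency carries at
least `n / (C log² n)` of it, so there are at most `π(n) / (n / log n)` times `C log n` of them. By
the prime number theorem this factor tends to 1, hence is also bounded; both bounds follow,
uniformly in `C`.

The prime number theorem is obtained by a Wiener–Ikehara argument. For `a u = ψ(e ^ u) e ^ (-u)`,
the Laplace transform of `a - 1` extends continuously to `0 ≤ re s`, because `ζ` has no zero on `re
s = 1`. Riemann–Lebesgue then makes Fejér averages of `a - 1` tend to 0
(`tendsto_integral_mul_kernel`), and monotonicity of `e ^ u a u` turns averages into pointwise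
limits (`tendsto_one_of_laplace_continuousOn`). Chebyshev-type estimates pass from `ψ` to `θ` to
`π`. -/

/-! ### Laplace transforms on the boundary line -/

section LaplaceKernel

open MeasureTheory Filter Topology Complex Set

/-- Fubini step: integrating a Laplace transform on a vertical segment against a test function. -/
theorem integral_laplace_mul_eq {b : ℝ → ℝ} {G : ℂ → ℂ} {k : ℝ → ℂ} {M R : ℝ}
    (hb : Measurable b) (hM : ∀ u, |b u| ≤ M) (hk : Continuous k)
    (hG : ∀ s : ℂ, 0 < s.re → ∫ u in Ioi (0 : ℝ), (b u : ℂ) * exp (-s * u) = G s)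
    {σ : ℝ} (hσ : 0 < σ) (y : ℝ) :
    ∫ t in -R..R, k t * exp (t * y * I) * G (σ + t * I) =
      ∫ u in Ioi (0 : ℝ), (b u * Real.exp (-σ * u) : ℝ) * ∫ t in -R..R, k t * exp (t * (y - u) * I) := by
  have h1 : ∀ t : ℝ, k t * exp (t * y * I) * G (σ + t * I) =
      ∫ u in Ioi (0 : ℝ), (b u * Real.exp (-σ * u) : ℝ) * (k t * exp (t * (y - u) * I)) := by
    intro t
    rw [← hG _ (by simpa using hσ), ← integral_const_mul]
    congr 1 with u
    have : exp (-(σ + t * I) * u) = exp (-σ * u) * exp (-(t * u * I)) := by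
      rw [← Complex.exp_add]; congr 1; ring
    have h2 : exp (t * (y - u) * I) = exp (t * y * I) * exp (-(t * u * I)) := by
      rw [← Complex.exp_add]; congr 1; ring
    rw [this, h2]; push_cast; ring
  simp_rw [h1]
  rw [MeasureTheory.intervalIntegral_integral_swap]
  · congr 1 with u
    rw [intervalIntegral.integral_const_mul]
  · have hu : IntegrableOn (fun u : ℝ ↦ M * Real.exp (-σ * u)) (Ioi 0) :=
      (integrableOn_exp_mul_Ioi (by linarith) 0).const_mul M
    have ht : Integrable (fun t : ℝ ↦ ‖k t‖) (volume.restrict (uIoc (-R) R)) :=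
      (hk.norm.intervalIntegrable (-R) R).def'
    refine (ht.mul_prod hu).mono' ?_ ?_
    · apply Measurable.aestronglyMeasurable
      have := hk.measurable
      simp only [Function.uncurry_def]
      fun_prop
    · refine .of_forall fun ⟨t, u⟩ ↦ ?_
      simp only [Function.uncurry_apply_pair, norm_mul, norm_real, Real.norm_eq_abs, Real.abs_exp]
      have : ‖exp (t * (y - u) * I)‖ = 1 := by
        have := norm_exp_ofReal_mul_I (t * (y - u))
        push_cast at this; exact this
      rw [this, mul_one, mul_comm]
      gcongr
      exact hM u

/-- Boundary version of `integral_laplace_mul_eq`. -/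
theorem integral_boundary_mul_eq {b : ℝ → ℝ} {G : ℂ → ℂ} {k : ℝ → ℂ} {M R : ℝ}
    (hb : Measurable b) (hM : ∀ u, |b u| ≤ M) (hk : Continuous k) (hR : 0 ≤ R)
    (hG : ∀ s : ℂ, 0 < s.re → ∫ u in Ioi (0 : ℝ), (b u : ℂ) * exp (-s * u) = G s)
    (hGc : ContinuousOn G {s | 0 ≤ s.re})
    (hK : Integrable fun v : ℝ ↦ ∫ t in -R..R, k t * exp (t * v * I)) (y : ℝ) :
    ∫ t in -R..R, k t * exp (t * y * I) * G (t * I) =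
      ∫ u in Ioi (0 : ℝ), (b u : ℂ) * ∫ t in -R..R, k t * exp (t * (y - u) * I) := by
  -- Let `σ → 0+` on both sides. On the left, `G` is bounded on the compact rectangle `[0, 1] × [-R,
  -- R]`.
  have hl : Tendsto (fun σ : ℝ ↦ ∫ t in -R..R, k t * exp (t * y * I) * G (σ + t * I))
      (𝓝[>] 0) (𝓝 (∫ t in -R..R, k t * exp (t * y * I) * G (t * I))) := by
    have hcpt : IsCompact (Icc (0 : ℝ) 1 ×ˢ Icc (-R) R) := isCompact_Icc.prod isCompact_Icc
    have hmaps : ∀ p ∈ Icc (0 : ℝ) 1 ×ˢ Icc (-R) R, 0 ≤ ((p.1 : ℂ) + p.2 * I).re := by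
      rintro ⟨σ, t⟩ ⟨⟨h, -⟩, -⟩; simpa using h
    have hGc' : ContinuousOn (fun p : ℝ × ℝ ↦ G (p.1 + p.2 * I)) (Icc (0 : ℝ) 1 ×ˢ Icc (-R) R) :=
      hGc.comp (by fun_prop) hmaps
    obtain ⟨B, hB⟩ := hcpt.exists_bound_of_continuousOn hGc'
    refine intervalIntegral.tendsto_integral_filter_of_dominated_convergence (fun t ↦ ‖k t‖ * B)
      ?_ ?_ ((hk.norm.mul continuous_const).intervalIntegrable _ _) ?_
    · filter_upwards [Ioc_mem_nhdsGT zero_lt_one] with σ hσ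
      rw [uIoc_of_le (by linarith)]
      refine ContinuousOn.aestronglyMeasurable (ContinuousOn.mul (by fun_prop) ?_) measurableSet_Ioc
      refine hGc.comp (by fun_prop) fun t _ ↦ ?_
      simpa using hσ.1.le
    · filter_upwards [Ioc_mem_nhdsGT zero_lt_one] with σ hσ
      refine .of_forall fun t ht ↦ ?_
      rw [uIoc_of_le (by linarith)] at ht
      have h1 : ‖exp (t * y * I)‖ = 1 := by
        have := norm_exp_ofReal_mul_I (t * y)
        push_cast at this; exact this
      rw [norm_mul, norm_mul, h1, mul_one]
      gcongr
      exact hB (σ, t) ⟨⟨hσ.1.le, hσ.2⟩, ht.1.le, ht.2⟩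
    · refine .of_forall fun t ht ↦ Tendsto.const_mul _ ?_
      have h0 : ContinuousWithinAt G {s | 0 ≤ s.re} (t * I) := hGc _ (by simp)
      refine h0.tendsto.comp (tendsto_nhdsWithin_iff.2 ⟨?_, ?_⟩)
      · have : Continuous fun σ : ℝ ↦ (σ : ℂ) + t * I := by fun_prop
        simpa using (this.tendsto 0).mono_left nhdsWithin_le_nhds
      · filter_upwards [self_mem_nhdsWithin] with σ hσ
        simpa using (le_of_lt hσ)
  -- On the right, the factor `exp (-σ * u)` is at most 1, so `M` times the norm of the integrable
  -- kernel dominates.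
  have hr : Tendsto (fun σ : ℝ ↦ ∫ u in Ioi (0 : ℝ), (b u * Real.exp (-σ * u) : ℝ) *
        ∫ t in -R..R, k t * exp (t * (y - u) * I)) (𝓝[>] 0)
      (𝓝 (∫ u in Ioi (0 : ℝ), (b u : ℂ) * ∫ t in -R..R, k t * exp (t * (y - u) * I))) := by
    have hK' : Integrable fun u : ℝ ↦ ∫ t in -R..R, k t * exp (t * (y - u) * I) := by
      have := hK.comp_sub_left y
      simpa only [ofReal_sub] using this
    refine tendsto_integral_filter_of_dominated_convergence
      (fun u ↦ M * ‖∫ t in -R..R, k t * exp (t * (y - u) * I)‖) ?_ ?_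
      (hK'.norm.const_mul M).integrableOn ?_
    · refine .of_forall fun σ ↦ ?_
      refine AEStronglyMeasurable.mul ?_ hK'.integrableOn.aestronglyMeasurable
      exact Measurable.aestronglyMeasurable (by fun_prop)
    · filter_upwards [self_mem_nhdsWithin] with σ hσ
      filter_upwards [ae_restrict_mem measurableSet_Ioi] with u hu
      rw [norm_mul, norm_real, Real.norm_eq_abs, abs_mul, Real.abs_exp]
      gcongr
      calc |b u| * Real.exp (-σ * u) ≤ |b u| * 1 := by
            gcongr
            rw [Real.exp_le_one_iff]
            have := mul_pos (mem_Ioi.1 hσ) (mem_Ioi.1 hu)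
            linarith
        _ ≤ M := by simpa using hM u
    · refine .of_forall fun u ↦ Tendsto.mul_const _ ?_
      have : Continuous fun σ : ℝ ↦ ((b u * Real.exp (-σ * u) : ℝ) : ℂ) := by fun_prop
      simpa using (this.tendsto 0).mono_left nhdsWithin_le_nhds
  refine tendsto_nhds_unique hl (hr.congr' ?_)
  filter_upwards [self_mem_nhdsWithin] with σ hσ
  exact (integral_laplace_mul_eq hb hM hk hG hσ y).symm

/-- The core of the Wiener–Ikehara theorem: if the Laplace transform of a bounded function extends
continuously to the imaginary axis, then averages of the function against a kernel with compactly
supported Fourier transform tend to zero. -/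
theorem tendsto_integral_mul_kernel {b : ℝ → ℝ} {G : ℂ → ℂ} {k : ℝ → ℂ} {M R : ℝ}
    (hb : Measurable b) (hM : ∀ u, |b u| ≤ M) (hk : Continuous k) (hR : 0 ≤ R)
    (hG : ∀ s : ℂ, 0 < s.re → ∫ u in Ioi (0 : ℝ), (b u : ℂ) * exp (-s * u) = G s)
    (hGc : ContinuousOn G {s | 0 ≤ s.re})
    (hK : Integrable fun v : ℝ ↦ ∫ t in -R..R, k t * exp (t * v * I)) :
    Tendsto (fun y : ℝ ↦ ∫ u in Ioi (0 : ℝ),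
      (b u : ℂ) * ∫ t in -R..R, k t * exp (t * (y - u) * I)) atTop (𝓝 0) := by
  simp_rw [← integral_boundary_mul_eq hb hM hk hR hG hGc hK]
  -- Riemann–Lebesgue; the frequency `-(y / (2π))` matches the normalisation `e(-t w)` of the
  -- Fourier character.
  have h := Real.tendsto_integral_exp_smul_cocompact
    ((Ioc (-R) R).indicator fun t : ℝ ↦ k t * G (t * I))
  have hy : Tendsto (fun y : ℝ ↦ -(y / (2 * Real.pi))) atTop (cocompact ℝ) :=
    (tendsto_neg_atTop_atBot.comp (tendsto_id.atTop_div_const (by positivity))).mono_right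
      atBot_le_cocompact
  refine (h.comp hy).congr fun y ↦ ?_
  rw [intervalIntegral.integral_of_le (by linarith), ← integral_indicator measurableSet_Ioc]
  simp only [Function.comp_apply]
  congr 1 with t
  by_cases ht : t ∈ Ioc (-R) R
  · simp only [indicator_of_mem ht, Circle.smul_def, Real.fourierChar_apply, smul_eq_mul]
    have : ((2 * Real.pi * -(t * -(y / (2 * Real.pi))) : ℝ) : ℂ) = t * y := by
      rw [← ofReal_mul]; congr 1; field_simp
    rw [this]; ring
  · simp [indicator_of_notMem ht]

end LaplaceKernel

/-! ### The Fejér kernel -/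

section Fejer

open MeasureTheory Filter Topology Set

/-- The Fejér kernel, as the Fourier transform of the triangle function on `[-1, 1]`. -/
noncomputable def fejerKernel (v : ℝ) : ℝ := ∫ t in (-1 : ℝ)..1, (1 - |t|) * Real.cos (t * v)

theorem continuous_fejerKernel : Continuous fejerKernel :=
  intervalIntegral.continuous_parametric_intervalIntegral_of_continuous' (by fun_prop) _ _

theorem fejerKernel_eq_two_mul (v : ℝ) :
    fejerKernel v = 2 * ∫ t in (0 : ℝ)..1, (1 - t) * Real.cos (t * v) := by
  have hc : Continuous fun t : ℝ ↦ (1 - |t|) * Real.cos (t * v) := by fun_prop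
  rw [fejerKernel, ← intervalIntegral.integral_add_adjacent_intervals
    (hc.intervalIntegrable (-1) 0) (hc.intervalIntegrable 0 1)]
  have h := intervalIntegral.integral_comp_neg (a := (0 : ℝ)) (b := 1)
    fun t : ℝ ↦ (1 - |t|) * Real.cos (t * v)
  simp only [neg_zero, abs_neg, neg_mul, Real.cos_neg] at h
  rw [← h, ← two_mul]
  congr 1
  refine intervalIntegral.integral_congr fun t ht ↦ ?_
  rw [uIcc_of_le zero_le_one] at ht
  simp only [abs_of_nonneg ht.1]

theorem fejerKernel_zero : fejerKernel 0 = 1 := by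
  rw [fejerKernel_eq_two_mul]
  simp only [mul_zero, Real.cos_zero, mul_one]
  rw [intervalIntegral.integral_sub (by simp) (by simp)]
  norm_num

/-- Integration by parts. The closed form makes nonnegativity and the `v⁻²` decay visible. -/
theorem fejerKernel_of_ne_zero {v : ℝ} (hv : v ≠ 0) :
    fejerKernel v = 2 * (1 - Real.cos v) / v ^ 2 := by
  have hd : ∀ t ∈ uIcc (0 : ℝ) 1, HasDerivAt
      (fun t ↦ (1 - t) * (Real.sin (t * v) / v) - Real.cos (t * v) / v ^ 2)
      ((1 - t) * Real.cos (t * v)) t := by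
    intro t _
    have h1 : HasDerivAt (fun t : ℝ ↦ t * v) v t := by simpa using (hasDerivAt_id t).mul_const v
    have h2 := ((hasDerivAt_id t).const_sub 1).mul (h1.sin.div_const v)
    refine (h2.sub (h1.cos.div_const (v ^ 2))).congr_deriv ?_
    simp only [id]
    field_simp
    ring
  rw [fejerKernel_eq_two_mul, intervalIntegral.integral_eq_sub_of_hasDerivAt hd
    (Continuous.intervalIntegrable (by fun_prop) _ _)]
  simp
  field_simp
  ring

theorem fejerKernel_nonneg (v : ℝ) : 0 ≤ fejerKernel v := by
  rcases eq_or_ne v 0 with rfl | hv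
  · simp [fejerKernel_zero]
  · rw [fejerKernel_of_ne_zero hv]
    have := Real.cos_le_one v
    have : 0 ≤ 1 - Real.cos v := by linarith
    positivity

theorem fejerKernel_le_one (v : ℝ) : fejerKernel v ≤ 1 := by
  rcases eq_or_ne v 0 with rfl | hv
  · simp [fejerKernel_zero]
  · rw [fejerKernel_of_ne_zero hv, div_le_one (by positivity)]
    have := Real.one_sub_sq_div_two_le_cos (x := v)
    linarith

theorem fejerKernel_le (v : ℝ) : fejerKernel v ≤ 8 * (1 + v ^ 2)⁻¹ := by
  rw [← div_eq_mul_inv, le_div_iff₀ (by positivity)]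
  rcases eq_or_ne v 0 with rfl | hv
  · simp [fejerKernel_zero]
  · have h1 := fejerKernel_le_one v
    have h2 : fejerKernel v * v ^ 2 ≤ 4 := by
      rw [fejerKernel_of_ne_zero hv, div_mul_cancel₀ _ (by positivity)]
      linarith [Real.neg_one_le_cos v]
    linarith

theorem integrable_fejerKernel : Integrable fejerKernel := by
  refine (integrable_inv_one_add_sq.const_mul 8).mono'
    continuous_fejerKernel.aestronglyMeasurable (.of_forall fun v ↦ ?_)
  rw [Real.norm_of_nonneg (fejerKernel_nonneg v)]
  exact fejerKernel_le v

theorem integral_fejerKernel_pos : 0 < ∫ v, fejerKernel v := by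
  refine integral_pos_of_integrable_nonneg_nonzero continuous_fejerKernel integrable_fejerKernel
    fejerKernel_nonneg (x := 0) ?_
  simp [fejerKernel_zero]

/-- Fourier transform of the triangle function of width `R`. -/
theorem integral_triangle_mul_exp {R : ℝ} (hR : 0 < R) (v : ℝ) :
    ∫ t in -R..R, ((1 - |t / R| : ℝ) : ℂ) * Complex.exp (t * v * Complex.I) =
      (R * fejerKernel (R * v) : ℝ) := by
  have h0 : ∀ w : ℝ, ∫ t in (-1 : ℝ)..1, ((1 - |t| : ℝ) : ℂ) * Complex.exp (t * w * Complex.I) =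
      (fejerKernel w : ℂ) := by
    intro w
    -- The sine part is odd, so only the cosine part survives.
    have hs : ∫ t in (-1 : ℝ)..1, (1 - |t|) * Real.sin (t * w) = 0 := by
      have h := intervalIntegral.integral_comp_neg (a := (-1 : ℝ)) (b := 1)
        fun t : ℝ ↦ (1 - |t|) * Real.sin (t * w)
      simp only [abs_neg, neg_mul, Real.sin_neg, mul_neg, neg_neg,
        intervalIntegral.integral_neg] at h
      linarith
    have h1 : ∀ t : ℝ, ((1 - |t| : ℝ) : ℂ) * Complex.exp (t * w * Complex.I) =
        (((1 - |t|) * Real.cos (t * w) : ℝ) : ℂ) +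
          (((1 - |t|) * Real.sin (t * w) : ℝ) : ℂ) * Complex.I := by
      intro t
      rw [Complex.exp_mul_I]; push_cast; ring
    simp_rw [h1]
    rw [intervalIntegral.integral_add (Continuous.intervalIntegrable (by fun_prop) _ _)
      (Continuous.intervalIntegrable (by fun_prop) _ _), intervalIntegral.integral_mul_const,
      intervalIntegral.integral_ofReal, intervalIntegral.integral_ofReal, hs, fejerKernel]
    simp
  have h2 := intervalIntegral.integral_comp_div (a := -R) (b := R)
    (fun t : ℝ ↦ ((1 - |t| : ℝ) : ℂ) * Complex.exp (t * (R * v : ℝ) * Complex.I)) hR.ne'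
  rw [neg_div, div_self hR.ne', h0] at h2
  rw [Complex.ofReal_mul, ← Complex.real_smul, ← h2]
  congr 1 with t
  congr 2
  push_cast
  have : (R : ℂ) ≠ 0 := by exact_mod_cast hR.ne'
  field_simp

section Scaled

variable {R : ℝ}

theorem integrable_scaled_fejerKernel (hR : 0 < R) (y : ℝ) :
    Integrable fun u ↦ R * fejerKernel (R * (y - u)) :=
  ((integrable_fejerKernel.comp_mul_left' hR.ne').comp_sub_left y).const_mul R

theorem integral_scaled_fejerKernel (hR : 0 < R) (y : ℝ) :
    ∫ u, R * fejerKernel (R * (y - u)) = ∫ v, fejerKernel v := by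
  rw [integral_const_mul, integral_sub_left_eq_self (fun v ↦ fejerKernel (R * v)) volume y,
    Measure.integral_comp_mul_left, abs_of_pos (inv_pos.2 hR), smul_eq_mul,
    mul_inv_cancel_left₀ hR.ne']

theorem intervalIntegral_scaled_fejerKernel (y a b : ℝ) :
    ∫ u in a..b, R * fejerKernel (R * (y - u)) =
      ∫ v in R * (y - b)..R * (y - a), fejerKernel v := by
  rw [intervalIntegral.integral_const_mul,
    intervalIntegral.integral_comp_sub_left (fun v ↦ fejerKernel (R * v)) y,
    intervalIntegral.mul_integral_comp_mul_left]

/-- A substitution turns the integral into one over `Iic (R * y)`, and these sets exhaust the line.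
-/
theorem tendsto_setIntegral_scaled_fejerKernel (hR : 0 < R) :
    Tendsto (fun y ↦ ∫ u in Ioi (0 : ℝ), R * fejerKernel (R * (y - u))) atTop
      (𝓝 (∫ v, fejerKernel v)) := by
  have h : ∀ y, ∫ u in Ioi (0 : ℝ), R * fejerKernel (R * (y - u)) =
      ∫ v in Iic (R * y), fejerKernel v := by
    intro y
    have h1 := intervalIntegral_tendsto_integral_Ioi 0
      (integrable_scaled_fejerKernel hR y).integrableOn tendsto_id
    refine tendsto_nhds_unique h1 ?_
    simp_rw [intervalIntegral_scaled_fejerKernel]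
    rw [sub_zero]
    refine intervalIntegral_tendsto_integral_Iic _ integrable_fejerKernel.integrableOn ?_
    refine Tendsto.const_mul_atBot hR ?_
    exact tendsto_atBot_add_const_left _ y (tendsto_neg_atTop_atBot)
  simp_rw [h]
  have h2 := (tendsto_id (α := ℝ) (x := atTop)).const_mul_atTop hR
  have := tendsto_setIntegral_of_monotone (μ := volume) (f := fejerKernel)
    (s := fun y : ℝ ↦ Iic (R * y)) (fun _ ↦ measurableSet_Iic)
    (fun a b hab ↦ Iic_subset_Iic.2 (by gcongr)) integrable_fejerKernel.integrableOn
  rwa [show ⋃ y : ℝ, Iic (R * y) = univ from eq_univ_of_forall fun x ↦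
    mem_iUnion.2 ⟨x / R, by simp [mul_div_cancel₀ _ hR.ne']⟩, setIntegral_univ] at this

end Scaled

end Fejer

/-! ### Tauberian theorem -/

section WienerIkehara

open MeasureTheory Filter Topology Set

section Tauberian

variable {a : ℝ → ℝ} {M R δ y : ℝ}

theorem integrable_mul_scaled_fejerKernel (ha : Measurable a) (h0 : ∀ u, 0 ≤ a u)
    (hM : ∀ u, a u ≤ M) (hR : 0 < R) (y : ℝ) :
    Integrable fun u ↦ a u * (R * fejerKernel (R * (y - u))) :=
  (integrable_scaled_fejerKernel hR y).bdd_mul (c := M) ha.aestronglyMeasurable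
    (.of_forall fun u ↦ by rw [Real.norm_of_nonneg (h0 u)]; exact hM u)

theorem scaled_fejerKernel_nonneg (hR : 0 < R) (v : ℝ) : 0 ≤ R * fejerKernel v :=
  mul_nonneg hR.le (fejerKernel_nonneg _)

/-- Since `e ^ u a u` increases, `a` loses at most a factor `exp (-(2δ))` on `[y, y + 2δ]`. The
kernel is centred in that window, and the rest of the integral is nonnegative. -/
theorem mul_integral_fejerKernel_le (ha : Measurable a) (h0 : ∀ u, 0 ≤ a u) (hM : ∀ u, a u ≤ M)
    (hmono : MonotoneOn (fun u ↦ Real.exp u * a u) (Ici 0)) (hR : 0 < R) (hδ : 0 < δ)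
    (hy : 0 ≤ y) :
    a y * Real.exp (-(2 * δ)) * ∫ v in -(R * δ)..R * δ, fejerKernel v ≤
      ∫ u in Ioi (0 : ℝ), a u * (R * fejerKernel (R * (y + δ - u))) := by
  have hi := integrable_mul_scaled_fejerKernel ha h0 hM hR (y + δ)
  have hk := integrable_scaled_fejerKernel hR (y + δ)
  have h1 : ∫ v in -(R * δ)..R * δ, fejerKernel v =
      ∫ u in Ioc y (y + 2 * δ), R * fejerKernel (R * (y + δ - u)) := by
    rw [← intervalIntegral.integral_of_le (by linarith), intervalIntegral_scaled_fejerKernel]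
    congr 1 <;> ring
  rw [h1, ← integral_const_mul]
  calc ∫ u in Ioc y (y + 2 * δ), a y * Real.exp (-(2 * δ)) * (R * fejerKernel (R * (y + δ - u)))
      ≤ ∫ u in Ioc y (y + 2 * δ), a u * (R * fejerKernel (R * (y + δ - u))) := by
        refine setIntegral_mono_on (hk.const_mul _).integrableOn hi.integrableOn
          measurableSet_Ioc fun u hu ↦ ?_
        refine mul_le_mul_of_nonneg_right ?_ (scaled_fejerKernel_nonneg hR _)
        have h2 : Real.exp y * a y ≤ Real.exp u * a u :=
          hmono (mem_Ici.2 hy) (mem_Ici.2 (hy.trans hu.1.le)) hu.1.le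
        have h3 : a u = Real.exp (-u) * (Real.exp u * a u) := by
          rw [← mul_assoc, ← Real.exp_add]; simp
        rw [h3]
        calc a y * Real.exp (-(2 * δ)) ≤ a y * Real.exp (-u + y) := by
              gcongr
              · exact h0 y
              · linarith [hu.2]
          _ = Real.exp (-u) * (Real.exp y * a y) := by rw [Real.exp_add]; ring
          _ ≤ _ := by gcongr
    _ ≤ _ := by
        refine setIntegral_mono_set hi.integrableOn (.of_forall fun u ↦ ?_)
          (show Ioc y (y + 2 * δ) ≤ Ioi 0 from fun u hu ↦ hy.trans_lt hu.1).eventuallyLE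
        exact mul_nonneg (h0 u) (scaled_fejerKernel_nonneg hR _)

/-- The mirror estimate: on `[y - 2δ, y]` monotonicity gives `a u ≤ a y * exp (2δ)`; outside this
window only `a ≤ M` is used, against the kernel's tail mass. -/
theorem integral_mul_fejerKernel_le (ha : Measurable a) (h0 : ∀ u, 0 ≤ a u) (hM : ∀ u, a u ≤ M)
    (hmono : MonotoneOn (fun u ↦ Real.exp u * a u) (Ici 0)) (hR : 0 < R) (hδ : 0 < δ)
    (hy : 0 ≤ y) :
    ∫ u in Ioi (0 : ℝ), a u * (R * fejerKernel (R * (y - δ - u))) ≤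
      a y * Real.exp (2 * δ) * (∫ v, fejerKernel v) +
        M * ((∫ v, fejerKernel v) - ∫ v in -(R * δ)..R * δ, fejerKernel v) := by
  have hM0 : 0 ≤ M := (h0 0).trans (hM 0)
  have hi := integrable_mul_scaled_fejerKernel ha h0 hM hR (y - δ)
  have hk := integrable_scaled_fejerKernel hR (y - δ)
  have h1 : ∫ v in -(R * δ)..R * δ, fejerKernel v =
      ∫ u in Ioc (y - 2 * δ) y, R * fejerKernel (R * (y - δ - u)) := by
    rw [← intervalIntegral.integral_of_le (by linarith), intervalIntegral_scaled_fejerKernel]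
    congr 1 <;> ring
  have hkI := hk.indicator (measurableSet_Ioc (a := y - 2 * δ) (b := y))
  have hks : Integrable fun u ↦ R * fejerKernel (R * (y - δ - u)) -
      (Ioc (y - 2 * δ) y).indicator (fun u ↦ R * fejerKernel (R * (y - δ - u))) u := hk.sub hkI
  rw [h1, ← integral_indicator measurableSet_Ioc, ← integral_scaled_fejerKernel hR (y - δ),
    ← integral_sub hk hkI, ← integral_const_mul, ← integral_const_mul,
    ← integral_add (hk.const_mul _) (hks.const_mul _)]
  have hnn : ∀ u, 0 ≤ R * fejerKernel (R * (y - δ - u)) :=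
    fun u ↦ scaled_fejerKernel_nonneg hR _
  have hle : ∀ u, (Ioc (y - 2 * δ) y).indicator (fun u ↦ R * fejerKernel (R * (y - δ - u))) u ≤
      R * fejerKernel (R * (y - δ - u)) := fun u ↦ indicator_le_self' (fun u _ ↦ hnn u) u
  have hA : 0 ≤ a y * Real.exp (2 * δ) := mul_nonneg (h0 y) (Real.exp_pos _).le
  have hbig := (hk.const_mul (a y * Real.exp (2 * δ))).add (hks.const_mul M)
  refine (setIntegral_mono_on hi.integrableOn hbig.integrableOn measurableSet_Ioi
    fun u hu ↦ ?_).trans (setIntegral_le_integral hbig (.of_forall fun u ↦ ?_))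
  · simp only [Pi.add_apply]
    by_cases hu' : u ∈ Ioc (y - 2 * δ) y
    · rw [indicator_of_mem hu', sub_self, mul_zero, add_zero]
      refine mul_le_mul_of_nonneg_right ?_ (hnn u)
      have h2 : Real.exp u * a u ≤ Real.exp y * a y :=
        hmono (mem_Ici.2 (le_of_lt hu)) (mem_Ici.2 hy) hu'.2
      have h3 : a u = Real.exp (-u) * (Real.exp u * a u) := by
        rw [← mul_assoc, ← Real.exp_add]; simp
      rw [h3]
      calc Real.exp (-u) * (Real.exp u * a u) ≤ Real.exp (-u) * (Real.exp y * a y) := by gcongr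
        _ = a y * Real.exp (-u + y) := by rw [Real.exp_add]; ring
        _ ≤ _ := by
          gcongr
          · exact h0 y
          · linarith [hu'.1]
    · rw [indicator_of_notMem hu', sub_zero]
      have := mul_le_mul_of_nonneg_right (hM u) (hnn u)
      have := mul_nonneg hA (hnn u)
      linarith
  · exact add_nonneg (mul_nonneg hA (hnn u)) (mul_nonneg hM0 (sub_nonneg.2 (hle u)))

/-- A Wiener–Ikehara theorem for bounded slowly decreasing functions: if the Laplace transform of
`a - 1` extends continuously to the imaginary axis, then `a` tends to `1`. -/
theorem tendsto_one_of_laplace_continuousOn {G : ℂ → ℂ} (ha : Measurable a) (h0 : ∀ u, 0 ≤ a u)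
    (hM : ∀ u, a u ≤ M) (hmono : MonotoneOn (fun u ↦ Real.exp u * a u) (Ici 0))
    (hG : ∀ s : ℂ, 0 < s.re →
      ∫ u in Ioi (0 : ℝ), ((a u - 1 : ℝ) : ℂ) * Complex.exp (-s * u) = G s)
    (hGc : ContinuousOn G {s | 0 ≤ s.re}) : Tendsto a atTop (𝓝 1) := by
  set c := ∫ v, fejerKernel v with hc
  have hc0 : 0 < c := integral_fejerKernel_pos
  -- The averages of `a - 1` vanish in the limit and those of 1 tend to `c`.
  have hJ : ∀ R : ℝ, 0 < R → Tendsto (fun y ↦ ∫ u in Ioi (0 : ℝ),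
      a u * (R * fejerKernel (R * (y - u)))) atTop (𝓝 c) := by
    intro R hR
    have h1 := tendsto_integral_mul_kernel (b := fun u ↦ a u - 1) (M := M + 1)
      (k := fun t ↦ ((1 - |t / R| : ℝ) : ℂ)) (R := R) (ha.sub_const 1)
      (fun u ↦ abs_le.2 ⟨by linarith [h0 u, hM u], by linarith [hM u]⟩) (by fun_prop) hR.le hG hGc
      (by
        simp_rw [integral_triangle_mul_exp hR]
        simpa using ((integrable_scaled_fejerKernel hR 0).comp_neg).ofReal (𝕜 := ℂ))
    have h2 : ∀ y : ℝ, ∫ u in Ioi (0 : ℝ), ((a u - 1 : ℝ) : ℂ) * ∫ t in -R..R,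
        ((1 - |t / R| : ℝ) : ℂ) * Complex.exp (t * (y - u) * Complex.I) =
        (((∫ u in Ioi (0 : ℝ), a u * (R * fejerKernel (R * (y - u)))) -
          ∫ u in Ioi (0 : ℝ), R * fejerKernel (R * (y - u)) : ℝ) : ℂ) := by
      intro y
      rw [← integral_sub (integrable_mul_scaled_fejerKernel ha h0 hM hR y).integrableOn
        (integrable_scaled_fejerKernel hR y).integrableOn, ← integral_complex_ofReal]
      congr 1 with u
      have := integral_triangle_mul_exp hR (y - u)
      push_cast at this ⊢
      rw [this]
      ring
    simp_rw [h2] at h1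
    have h3 := (Complex.continuous_re.tendsto 0).comp h1
    simp only [Function.comp_def, Complex.ofReal_re, Complex.zero_re] at h3
    simpa using h3.add (tendsto_setIntegral_scaled_fejerKernel hR)
  -- With `R = δ⁻²`, the rescaled half-width `R * δ = 1 / δ` grows as `δ → 0`: the window shrinks
  -- yet captures all the kernel mass.
  have hI : Tendsto (fun δ : ℝ ↦ ∫ v in -(δ⁻¹ ^ 2 * δ)..δ⁻¹ ^ 2 * δ, fejerKernel v) (𝓝[>] 0)
      (𝓝 c) := by
    have h1 : Tendsto (fun δ : ℝ ↦ δ⁻¹ ^ 2 * δ) (𝓝[>] 0) atTop := by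
      refine tendsto_inv_nhdsGT_zero.congr' ?_
      filter_upwards [self_mem_nhdsWithin] with δ hδ
      have : δ ≠ 0 := ne_of_gt hδ
      field_simp
    exact intervalIntegral_tendsto_integral integrable_fejerKernel
      (tendsto_neg_atTop_atBot.comp h1) h1
  have hexp : ∀ r : ℝ, Tendsto (fun δ : ℝ ↦ Real.exp (r * δ)) (𝓝[>] 0) (𝓝 1) := by
    intro r
    have : Continuous fun δ : ℝ ↦ Real.exp (r * δ) := by fun_prop
    simpa using (this.tendsto 0).mono_left nhdsWithin_le_nhds
  refine tendsto_order.2 ⟨fun l hl ↦ ?_, fun l hl ↦ ?_⟩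
  -- This is the upper estimate with `a y` replaced by `l`. Its limit is `l * c < c`, so for a small
  -- `δ` the averages eventually exceed it, which forces `l < a y`.
  · have hlim : Tendsto (fun δ : ℝ ↦ l * Real.exp (2 * δ) * c +
        M * (c - ∫ v in -(δ⁻¹ ^ 2 * δ)..δ⁻¹ ^ 2 * δ, fejerKernel v)) (𝓝[>] 0) (𝓝 (l * c)) := by
      simpa using (((hexp 2).const_mul l).mul_const c).add ((hI.const_sub c).const_mul M)
    obtain ⟨δ, hδl, hδ⟩ := ((hlim.eventually_lt_const
      (show l * c < c by nlinarith)).and self_mem_nhdsWithin).exists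
    have hδ : 0 < δ := hδ
    have hR : 0 < δ⁻¹ ^ 2 := by positivity
    have hJ' := (hJ _ hR).comp (tendsto_atTop_add_const_right _ (-δ) tendsto_id)
    filter_upwards [hJ'.eventually_const_lt hδl, eventually_ge_atTop 0] with y hy hy0
    have hle := integral_mul_fejerKernel_le ha h0 hM hmono hR hδ hy0
    simp only [Function.comp_apply, id, ← sub_eq_add_neg] at hy
    have h3 := hy.trans_le hle
    rw [add_lt_add_iff_right, mul_lt_mul_iff_left₀ hc0, mul_lt_mul_iff_left₀ (Real.exp_pos _)] at h3
    exact h3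
  · have hlim : Tendsto (fun δ : ℝ ↦ l * Real.exp (-2 * δ) *
        ∫ v in -(δ⁻¹ ^ 2 * δ)..δ⁻¹ ^ 2 * δ, fejerKernel v) (𝓝[>] 0) (𝓝 (l * c)) := by
      simpa using ((hexp (-2)).const_mul l).mul hI
    obtain ⟨δ, ⟨hδl, hδI⟩, hδ⟩ := (((hlim.eventually_const_lt
      (show c < l * c by nlinarith)).and (hI.eventually_const_lt hc0)).and
      self_mem_nhdsWithin).exists
    have hδ : 0 < δ := hδ
    have hR : 0 < δ⁻¹ ^ 2 := by positivity
    have hJ' := (hJ _ hR).comp (tendsto_atTop_add_const_right _ δ tendsto_id)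
    filter_upwards [hJ'.eventually_lt_const hδl, eventually_ge_atTop 0] with y hy hy0
    have hle := mul_integral_fejerKernel_le ha h0 hM hmono hR hδ hy0
    simp only [Function.comp_apply, id] at hy
    have h3 := hle.trans_lt hy
    rw [neg_mul, mul_lt_mul_iff_left₀ hδI, mul_lt_mul_iff_left₀ (Real.exp_pos _)] at h3
    exact h3

end Tauberian

end WienerIkehara

/-! ### Prime number theorem -/

section PrimeNumberTheorem

open MeasureTheory Filter Topology Set Asymptotics
open scoped Chebyshev ArithmeticFunction.vonMangoldt

/-- The Laplace transform of `ψ (e ^ u) e ^ (-u) - 1`, as a function that makes sense on the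
closed half-plane `0 ≤ re s`. -/
noncomputable def psiLaplace (s : ℂ) : ℂ :=
  (ArithmeticFunction.vonMangoldt.LFunctionResidueClassAux (1 : ZMod 1) (s + 1) - 1) / (s + 1)

/-- The arithmetic input: continuity of the auxiliary function up to `re s = 1` encodes the
nonvanishing of `ζ` there. -/
theorem continuousOn_psiLaplace : ContinuousOn psiLaplace {s | 0 ≤ s.re} := by
  refine ContinuousOn.div (ContinuousOn.sub ?_ continuousOn_const) (by fun_prop) ?_
  · refine (ArithmeticFunction.vonMangoldt.continuousOn_LFunctionResidueClassAux (1 : ZMod 1)).comp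
      (by fun_prop) fun s hs ↦ ?_
    simpa using hs
  · intro s hs h
    have := congrArg Complex.re h
    simp only [Complex.add_re, Complex.one_re, Complex.zero_re] at this
    have hs' : 0 ≤ s.re := hs
    linarith

/-- Abel summation, legitimate because Chebyshev's bound makes the partial sums of `Λ` of order `n`.
-/
theorem LSeries_vonMangoldt_eq_mul_integral {s : ℂ} (hs : 1 < s.re) :
    LSeries (fun n ↦ (Λ n : ℂ)) s = s * ∫ t in Ioi (1 : ℝ), (ψ t : ℂ) * (t : ℂ) ^ (-(s + 1)) := by
  have hsum : ∀ n : ℕ, ∑ k ∈ Finset.Icc 1 n, Λ k = ψ n := by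
    intro n
    rw [Chebyshev.psi, Nat.floor_natCast]
    rfl
  rw [LSeries_eq_mul_integral_of_nonneg (fun n ↦ Λ n) zero_le_one hs ?_
    fun _ ↦ ArithmeticFunction.vonMangoldt_nonneg]
  · congr 2 with t
    rw [← Complex.ofReal_sum, hsum, ← Chebyshev.psi_eq_psi_coe_floor]
  · simp_rw [hsum, Real.rpow_one]
    refine IsBigO.of_bound (Real.log 4 + 4) (.of_forall fun n ↦ ?_)
    rw [Real.norm_of_nonneg (Chebyshev.psi_nonneg _), Real.norm_of_nonneg n.cast_nonneg]
    exact Chebyshev.psi_le_const_mul_self n.cast_nonneg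

theorem measurable_psi : Measurable ψ := Chebyshev.psi_mono.measurable

theorem psi_exp_mul_exp_neg_le (u : ℝ) : ψ (Real.exp u) * Real.exp (-u) ≤ Real.log 4 + 4 := by
  have := Chebyshev.psi_le_const_mul_self (Real.exp_pos u).le
  rw [Real.exp_neg, ← div_eq_mul_inv, div_le_iff₀ (Real.exp_pos u)]
  exact this

/-- After `t = e ^ u` the `ψ` part is `L(s + 1) / (s + 1)`, while the constant 1 contributes `1 /
s`. Then `L / (s + 1) - 1 / s = (L - 1 / s - 1) / (s + 1)`, with the pole removed. -/
theorem integral_psi_exp_sub_one {s : ℂ} (hs : 0 < s.re) :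
    ∫ u in Ioi (0 : ℝ), ((ψ (Real.exp u) * Real.exp (-u) - 1 : ℝ) : ℂ) * Complex.exp (-s * u) =
      psiLaplace s := by
  have hs0 : s ≠ 0 := fun h ↦ by simp [h] at hs
  have hs1 : s + 1 ≠ 0 := fun h ↦ by
    have := congrArg Complex.re h
    simp only [Complex.add_re, Complex.one_re, Complex.zero_re] at this
    linarith
  have hre : 1 < (s + 1).re := by simpa using hs
  have hexp : IntegrableOn (fun u : ℝ ↦ Complex.exp (-s * u)) (Ioi 0) :=
    integrableOn_exp_mul_complex_Ioi (by simpa using hs) 0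
  have hpsi : IntegrableOn (fun u : ℝ ↦
      ((ψ (Real.exp u) * Real.exp (-u) : ℝ) : ℂ) * Complex.exp (-s * u)) (Ioi 0) := by
    refine Integrable.bdd_mul (c := Real.log 4 + 4) hexp ?_ (.of_forall fun u ↦ ?_)
    · have := measurable_psi
      exact Measurable.aestronglyMeasurable (by fun_prop)
    · rw [Complex.norm_real, Real.norm_of_nonneg
        (mul_nonneg (Chebyshev.psi_nonneg _) (Real.exp_pos _).le)]
      exact psi_exp_mul_exp_neg_le u
  have h1 : ∫ u in Ioi (0 : ℝ), ((ψ (Real.exp u) * Real.exp (-u) : ℝ) : ℂ) * Complex.exp (-s * u) =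
      ∫ t in Ioi (1 : ℝ), (ψ t : ℂ) * (t : ℂ) ^ (-(s + 1 + 1)) := by
    rw [← Real.exp_zero, ← integral_comp_exp_Ioi]
    congr 1 with u
    rw [Complex.real_smul, Complex.cpow_def_of_ne_zero (by simp),
      ← Complex.ofReal_log (Real.exp_pos u).le, Real.log_exp, Complex.ofReal_mul, mul_assoc,
      mul_left_comm (Complex.ofReal (Real.exp u)), Complex.ofReal_exp, Complex.ofReal_exp,
      ← Complex.exp_add, ← Complex.exp_add]
    congr 2
    push_cast
    ring
  have h2 : ∫ u in Ioi (0 : ℝ), Complex.exp (-s * u) = 1 / s := by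
    rw [integral_exp_mul_complex_Ioi (by simpa using hs)]
    simp
  have h3 := ArithmeticFunction.vonMangoldt.eqOn_LFunctionResidueClassAux
    (isUnit_one (M := ZMod 1)) hre
  -- Modulo 1 the only residue class is everything.
  have h4 : (ArithmeticFunction.vonMangoldt.residueClass (1 : ZMod 1)) = fun n ↦ Λ n := by
    funext n
    exact indicator_of_mem (s := {n : ℕ | (n : ZMod 1) = 1}) (Subsingleton.elim (n : ZMod 1) 1) _
  rw [h4] at h3
  beta_reduce at h3
  rw [LSeries_vonMangoldt_eq_mul_integral hre, ← h1] at h3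
  simp_rw [Complex.ofReal_sub, Complex.ofReal_one, sub_mul, one_mul]
  rw [integral_sub hpsi hexp, h2, psiLaplace, h3, Nat.totient_one]
  generalize (∫ u in Ioi (0 : ℝ), ((ψ (Real.exp u) * Real.exp (-u) : ℝ) : ℂ) * Complex.exp (-s * u))
    = J
  simp only [Nat.cast_one, add_sub_cancel_right]
  field_simp
  ring

/-- **Prime Number Theorem** for the Chebyshev function `ψ`. -/
theorem psi_isEquivalent : ψ ~[atTop] fun x ↦ x := by
  have h := tendsto_one_of_laplace_continuousOn
    (a := fun u ↦ ψ (Real.exp u) * Real.exp (-u)) (M := Real.log 4 + 4)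
    (by have := measurable_psi; fun_prop)
    (fun u ↦ mul_nonneg (Chebyshev.psi_nonneg _) (Real.exp_pos _).le)
    psi_exp_mul_exp_neg_le
    (by
      refine Monotone.monotoneOn (fun u v huv ↦ ?_) _
      have h : ∀ w, Real.exp w * (ψ (Real.exp w) * Real.exp (-w)) = ψ (Real.exp w) := fun w ↦ by
        rw [mul_left_comm, ← Real.exp_add, add_neg_cancel, Real.exp_zero, mul_one]
      simp only [h]
      exact Chebyshev.psi_mono (Real.exp_le_exp.2 huv))
    (fun s hs ↦ integral_psi_exp_sub_one hs) continuousOn_psiLaplace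
  refine (isEquivalent_iff_tendsto_one ?_).2 ?_
  · filter_upwards [eventually_ne_atTop 0] with x hx using hx
  · refine (h.comp Real.tendsto_log_atTop).congr' ?_
    filter_upwards [eventually_gt_atTop 0] with x hx
    simp [Real.exp_log hx, Real.exp_neg, div_eq_mul_inv]

/-- **Prime Number Theorem** for the Chebyshev function `θ`. -/
theorem theta_isEquivalent : θ ~[atTop] fun x ↦ x := by
  have h : (ψ - θ) =o[atTop] fun x : ℝ ↦ x := by
    refine Chebyshev.isBigO_psi_sub_theta_sqrt.trans_isLittleO ?_
    refine isLittleO_iff_tendsto' ?_ |>.mpr ?_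
    · filter_upwards [eventually_ne_atTop 0] with x hx h using absurd h hx
    · simpa [Real.sqrt_div_self, Pi.inv_def] using Real.tendsto_sqrt_atTop.inv_tendsto_atTop
  have := psi_isEquivalent.sub_isLittleO h
  simpa using this

/-- The **Prime Number Theorem**. -/
theorem primeCounting_isEquivalent :
    (fun n : ℕ ↦ (Nat.primeCounting n : ℝ)) ~[atTop] fun n ↦ n / Real.log n := by
  have h1 : (fun x : ℝ ↦ θ x / Real.log x) ~[atTop] fun x ↦ x / Real.log x :=
    theta_isEquivalent.div .refl
  have h2 : (fun x : ℝ ↦ (Nat.primeCounting ⌊x⌋₊ : ℝ) - θ x / Real.log x) =o[atTop]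
      fun x ↦ x / Real.log x := by
    refine Chebyshev.primeCounting_sub_theta_div_log_isBigO.trans_isLittleO ?_
    refine isLittleO_iff_tendsto' (by simp) |>.mpr ?_
    refine Tendsto.congr' ?_ Real.tendsto_log_atTop.inv_tendsto_atTop
    filter_upwards [eventually_gt_atTop 0] with x _
    simp only [Pi.inv_apply]
    field
  have h3 := (h1.add_isLittleO h2).comp_tendsto tendsto_natCast_atTop_atTop
  refine h3.congr_left (.of_forall fun n ↦ ?_)
  simp

end PrimeNumberTheorem

/-! ### Parseval and large frequencies -/

section Fourier

open Filter Topology Asymptotics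

/-- Parseval's identity for the discrete Fourier transform. -/
theorem ZMod.sum_norm_sq_dft {N : ℕ} [NeZero N] (Φ : ZMod N → ℂ) :
    ∑ k, ‖ZMod.dft Φ k‖ ^ 2 = N * ∑ j, ‖Φ j‖ ^ 2 := by
  have hconj : ∀ k, starRingEnd ℂ (ZMod.dft Φ k) =
      ∑ j, ZMod.stdAddChar (j * k) * starRingEnd ℂ (Φ j) := by
    intro k
    simp only [ZMod.dft_apply, smul_eq_mul, map_sum, map_mul, AddChar.map_neg_eq_conj,
      Complex.conj_conj]
  -- Fourier inversion, from the double transform being `N` times reflection.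
  have hinv : ∀ j, ∑ k, ZMod.stdAddChar (j * k) * ZMod.dft Φ k = N * Φ j := by
    intro j
    have h := congrFun (ZMod.dft_dft Φ) (-j)
    simp only [ZMod.dft_apply (ZMod.dft Φ), smul_eq_mul, mul_neg, neg_neg] at h
    rw [← h]
    exact Finset.sum_congr rfl fun k _ ↦ by rw [mul_comm j k]
  have h : ∑ k, ZMod.dft Φ k * starRingEnd ℂ (ZMod.dft Φ k) =
      N * ∑ j, Φ j * starRingEnd ℂ (Φ j) := by
    simp_rw [hconj, Finset.mul_sum]
    rw [Finset.sum_comm]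
    refine Finset.sum_congr rfl fun j _ ↦ ?_
    rw [← mul_assoc, ← hinv, Finset.sum_mul]
    exact Finset.sum_congr rfl fun k _ ↦ by ring
  simp_rw [Complex.mul_conj, Complex.normSq_eq_norm_sq] at h
  exact_mod_cast h

theorem primeCharMod_sq (n : ℕ) (x : ZMod n) : primeCharMod n x ^ 2 = primeCharMod n x := by
  unfold primeCharMod primeChar
  split_ifs <;> simp

theorem sum_norm_sq_primeFourier (n : ℕ) [NeZero n] :
    1 / (n : ℝ) * ∑ ξ : ZMod n, ‖primeFourier n ξ‖ ^ 2 = ∑ x : ZMod n, primeCharMod n x := by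
  have hn : (n : ℝ) ≠ 0 := Nat.cast_ne_zero.2 (NeZero.ne n)
  simp_rw [primeFourier, ZMod.sum_norm_sq_dft, Complex.norm_real, Real.norm_eq_abs, sq_abs,
    primeCharMod_sq]
  field_simp

/-- `posRep` is a bijection onto `{1, …, n}`. Representing the zero class by `n` matters when `n` is
prime. -/
theorem sum_primeCharMod (n : ℕ) [NeZero n] :
    ∑ x : ZMod n, primeCharMod n x = Nat.primeCounting n := by
  have h : ∑ x : ZMod n, primeCharMod n x = ∑ m ∈ Finset.Icc 1 n, primeChar m := by
    refine Finset.sum_bij (fun x _ ↦ x.posRep) (fun x _ ↦ ?_) (fun x _ y _ hxy ↦ ?_)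
      (fun m hm ↦ ?_) (fun x _ ↦ rfl)
    · rw [Finset.mem_Icc, ZMod.posRep]
      split_ifs with hx
      · exact ⟨Nat.one_le_iff_ne_zero.2 (NeZero.ne n), le_rfl⟩
      · exact ⟨Nat.one_le_iff_ne_zero.2 ((ZMod.val_eq_zero x).not.2 hx), (ZMod.val_lt x).le⟩
    · have hcast : ∀ z : ZMod n, ((z.posRep : ℕ) : ZMod n) = z := by
        intro z
        rw [ZMod.posRep]
        split_ifs with hz
        · simp [hz]
        · exact ZMod.natCast_zmod_val z
      rw [← hcast x, ← hcast y]
      exact congrArg _ hxy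
    · obtain ⟨hm1, hmn⟩ := Finset.mem_Icc.1 hm
      refine ⟨(m : ZMod n), Finset.mem_univ _, ?_⟩
      rcases hmn.eq_or_lt with rfl | hlt
      · simp [ZMod.posRep]
      · have hv : ((m : ZMod n)).val = m := ZMod.val_cast_of_lt hlt
        have h0 : (m : ZMod n) ≠ 0 := fun h ↦ by
          rw [h, ZMod.val_zero] at hv
          omega
        rw [ZMod.posRep, if_neg h0, hv]
  rw [h, ← Nat.primesLE_card_eq_primeCounting, Finset.card_eq_sum_ones, Nat.cast_sum]
  simp only [primeChar]
  rw [← Finset.sum_filter]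
  refine Finset.sum_congr ?_ fun _ _ ↦ by simp
  ext p
  simp only [Finset.mem_filter, Finset.mem_Icc, Nat.mem_primesLE]
  exact ⟨fun h ↦ ⟨h.1.2, h.2⟩, fun h ↦ ⟨⟨h.2.one_lt.le, h.1⟩, h.2⟩⟩

/-- Chebyshev's inequality for the energy distribution of `primeFourier`. -/
theorem ncard_largeFrequencies_le {n : ℕ} [NeZero n] (hn : 2 ≤ n) {C : ℝ} (hC : 0 < C) :
    ((largeFrequencies n C).ncard : ℝ) ≤
      Nat.primeCounting n / (n / Real.log n) * (C * Real.log n) := by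
  have hn0 : (0 : ℝ) < n := by positivity
  have hlog : 0 < Real.log n := Real.log_pos (by exact_mod_cast hn)
  have h : ((largeFrequencies n C).ncard : ℝ) * (n / (C * Real.log n ^ 2)) ≤
      Nat.primeCounting n := by
    classical
    rw [Set.ncard_eq_toFinset_card', ← nsmul_eq_mul, ← sum_primeCharMod,
      ← sum_norm_sq_primeFourier, Finset.mul_sum]
    refine (Finset.card_nsmul_le_sum _ (fun ξ ↦ 1 / (n : ℝ) * ‖primeFourier n ξ‖ ^ 2) _
      fun ξ hξ ↦ ?_).trans (Finset.sum_le_univ_sum_of_nonneg fun ξ ↦ by positivity)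
    have hξ' : ξ ∈ largeFrequencies n C := Set.mem_toFinset.1 hξ
    exact hξ'
  rw [← le_div_iff₀ (by positivity)] at h
  refine h.trans_eq ?_
  field_simp

theorem tendsto_primeCounting_div :
    Tendsto (fun n : ℕ ↦ (Nat.primeCounting n : ℝ) / (n / Real.log n)) atTop (𝓝 1) := by
  refine (isEquivalent_iff_tendsto_one ?_).1 primeCounting_isEquivalent
  filter_upwards [eventually_ge_atTop 2] with n hn
  have hlog : 0 < Real.log n := Real.log_pos (by exact_mod_cast hn)
  have hn0 : (0 : ℝ) < n := by positivity
  positivity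

theorem PNat.tendsto_coe_atTop : Tendsto (fun n : ℕ+ ↦ (n : ℕ)) atTop atTop :=
  tendsto_atTop_atTop.2 fun b ↦ ⟨b.succPNat, fun _ hn ↦
    (Nat.le_succ b).trans (PNat.coe_le_coe _ _ |>.2 hn)⟩

end Fourier

theorem mainTheorem5 :
    (∀ n : ℕ+, 1 / (n : ℝ) * ∑ ξ : ZMod n, ‖primeFourier n ξ‖ ^ 2
        = ∑ x : ZMod n, primeCharMod n x) ∧
    Asymptotics.IsEquivalent Filter.atTop
      (fun n : ℕ+ => ∑ x : ZMod n, primeCharMod n x)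
      (fun n : ℕ+ => (n : ℝ) / Real.log (n : ℝ)) ∧
    (∃ K : ℝ, 0 < K ∧ ∀ n : ℕ+, 2 ≤ n → ∀ C : ℝ, 0 < C →
      ((largeFrequencies n C).ncard : ℝ) ≤ K * (C * Real.log (n : ℝ))) ∧
    (∀ ε : ℝ, 0 < ε → ∀ᶠ n : ℕ+ in Filter.atTop, ∀ C : ℝ, 0 < C →
      ((largeFrequencies n C).ncard : ℝ) ≤ (1 + ε) * (C * Real.log (n : ℝ))) := by

  refine ⟨fun n ↦ sum_norm_sq_primeFourier n, ?_, ?_, fun ε hε ↦ ?_⟩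
  · simp_rw [sum_primeCharMod]
    exact primeCounting_isEquivalent.comp_tendsto PNat.tendsto_coe_atTop
  -- A convergent sequence is bounded, which also covers small `n`; the maximum with 1 only secures
  -- positivity.
  · obtain ⟨K, hK⟩ := tendsto_primeCounting_div.bddAbove_range
    refine ⟨max K 1, by positivity, fun n hn C hC ↦ ?_⟩
    have hn' : 2 ≤ (n : ℕ) := PNat.coe_le_coe _ _ |>.2 hn
    have hlog : 0 < Real.log (n : ℕ) := Real.log_pos (by exact_mod_cast hn')
    refine (ncard_largeFrequencies_le hn' hC).trans ?_
    gcongr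
    exact (hK (Set.mem_range_self (n : ℕ))).trans (le_max_left _ _)
  · have h := PNat.tendsto_coe_atTop.eventually
      (tendsto_primeCounting_div.eventually_le_const (show 1 < 1 + ε by linarith))
    filter_upwards [h, PNat.tendsto_coe_atTop.eventually_ge_atTop 2] with n hn hn2 C hC
    have hlog : 0 < Real.log (n : ℕ) := Real.log_pos (by exact_mod_cast hn2)
    refine (ncard_largeFrequencies_le hn2 hC).trans ?_
    gcongr
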